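/- For a set-valued map $F\colon\mathbb{R}^n\rightrightarrows\mathbb{R}^n$, a solution to $\dot x\in F(x)$ is a function $\phi$ defined on an interval $\operatorname{dom}\phi\subset\mathbb{R}_{\ge 0}$ containing $0$, absolutely continuous on each compact subinterval of $\operatorname{dom}\phi$, with $\dot\phi(t)\in F(\phi(t))$ for almost all $t\in\operatorname{dom}\phi$. It is maximal if no solution with a strictly larger domain extends it, and complete if $\sup\operatorname{dom}\phi=\infty$. Write $|y|_{\mathcal A}$ for the Euclidean distance of $y$ to $\mathcal A$. A nonempty closed set $\mathcal{A}\subset\mathbb{R}^n$ is uniformly globally asymptotically stable (UGAS) for $\dot x\in F(x)$ if (i) there is a continuous, strictly increasing, unbounded function $\kappa\colon\mathbb{R}_{\ge0}\to\mathbb{R}_{\ge0}$ with $\kappa(0)=0$ such that every solution $\phi$ satisfies $|\phi(t)|_{\mathcal A}\le\kappa(|\phi(0)|_{\mathcal A})$ for all $t\in\operatorname{dom}\phi$; and (ii) every maximal solution is complete, and for all $\varepsilon>0$ and $\mu>0$ there is $T>0$ such that for every solution $\phi$ with $|\phi(0)|_{\mathcal A}\le\mu$ and every $t\in\operatorname{dom}\phi$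 with $t\ge T$ one has $|\phi(t)|_{\mathcal A}\le\varepsilon$. **Proposition.** Let $F\colon\mathbb{R}^n\rightrightarrows\mathbb{R}^n$ satisfy the basic conditions: $F$ is outer semicontinuous (if $x_i\to x$, $y_i\in F(x_i)$ and $y_i\to y$, then $y\in F(x)$) and locally bounded (every $x$ has a neighbourhood $U$ such that $\bigcup_{z\in U}F(z)$ is bounded), and $F(x)$ is convex and nonempty for every $x\in\mathbb{R}^n$. Let $V\colon\mathbb{R}^n\to\mathbb{R}$ be continuously differentiable with $V(x)>0$ for all $x\ne0$ and $V(x)\to\infty$ as $\|x\|\to\infty$, and let $\rho,\alpha>0$ be such that $$\langle\nabla V(x),f\rangle\le-\rho V(x)\qquad\text{for all } x \text{ with } V(x)\ge\alpha \text{ and all } f\in F(x).$$ Then the set $\mathcal{A}:=\mathbb{R}^n\setminus\operatorname{Int}\{x\in\mathbb{R}^n : V(x)\ge\alpha\}$ is (nonempty, closed and) UGAS for $\dot x\in F(x)$. -/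

import Mathlib

open scoped NNReal Topology

namespace DiffIncl

/-- A set-valued map is outer semicontinuous if, whenever `x i → x`, `y i ∈ F (x i)` and
`y i → y`, one has `y ∈ F x`. -/
def OuterSemicontinuous {n : ℕ}
    (F : EuclideanSpace ℝ (Fin n) → Set (EuclideanSpace ℝ (Fin n))) : Prop :=
  ∀ (x y : EuclideanSpace ℝ (Fin n)) (u w : ℕ → EuclideanSpace ℝ (Fin n)),
    Filter.Tendsto u Filter.atTop (𝓝 x) → (∀ i, w i ∈ F (u i)) →
    Filter.Tendsto w Filter.atTop (𝓝 y) → y ∈ F x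

/-- A set-valued map is locally bounded if every point has a neighbourhood whose image
(the union of the values over the neighbourhood) is bounded. -/
def LocallyBounded {n : ℕ}
    (F : EuclideanSpace ℝ (Fin n) → Set (EuclideanSpace ℝ (Fin n))) : Prop :=
  ∀ x, ∃ U ∈ 𝓝 x, Bornology.IsBounded (⋃ z ∈ U, F z)

/-- The basic conditions on a set-valued map `F` on `ℝⁿ`. -/
structure BasicConditions {n : ℕ}
    (F : EuclideanSpace ℝ (Fin n) → Set (EuclideanSpace ℝ (Fin n))) : Prop where
  outerSemicontinuous : OuterSemicontinuous F
  convex : ∀ x, Convex ℝ (F x)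
  nonempty : ∀ x, (F x).Nonempty
  locallyBounded : LocallyBounded F

/-- `φ`, restricted to the domain `D`, is a solution of `ẋ ∈ F x`: `D` is an interval of
`[0, ∞)` containing `0`, `φ` is absolutely continuous on every compact subinterval of `D`, and
for almost every `t ∈ D` the derivative of `φ` at `t` exists and lies in `F (φ t)`.
The values of `φ` outside `D` are irrelevant. -/
structure IsSolution {n : ℕ} (F : EuclideanSpace ℝ (Fin n) → Set (EuclideanSpace ℝ (Fin n)))
    (D : Set ℝ) (φ : ℝ → EuclideanSpace ℝ (Fin n)) : Prop where
  ordConnected : D.OrdConnected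
  nonneg : ∀ t ∈ D, 0 ≤ t
  zero_mem : (0 : ℝ) ∈ D
  absolutelyContinuous : ∀ a ∈ D, ∀ b ∈ D, AbsolutelyContinuousOnInterval φ a b
  deriv_mem : ∀ᵐ t : ℝ, t ∈ D → ∃ v ∈ F (φ t), HasDerivWithinAt φ v D t

/-- A solution is maximal if no other solution with a strictly larger domain extends it. -/
def IsMaximalSolution {n : ℕ} (F : EuclideanSpace ℝ (Fin n) → Set (EuclideanSpace ℝ (Fin n)))
    (D : Set ℝ) (φ : ℝ → EuclideanSpace ℝ (Fin n)) : Prop :=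
  IsSolution F D φ ∧
    ¬ ∃ (D' : Set ℝ) (ψ : ℝ → EuclideanSpace ℝ (Fin n)),
      IsSolution F D' ψ ∧ D ⊂ D' ∧ ∀ t ∈ D, φ t = ψ t

/-- A solution with domain `D` is complete if `sup D = ∞`. -/
def IsCompleteDomain (D : Set ℝ) : Prop := ¬ BddAbove D

/-- Functions of class `𝒦∞`. -/
structure IsClassKInfty (κ : ℝ≥0 → ℝ≥0) : Prop where
  continuous : Continuous κ
  map_zero : κ 0 = 0
  strictMono : StrictMono κ
  unbounded : ¬ BddAbove (Set.range κ)

/-- Global uniform stability of `A` for `ẋ ∈ F x`. -/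
def GloballyUniformlyStable {n : ℕ}
    (F : EuclideanSpace ℝ (Fin n) → Set (EuclideanSpace ℝ (Fin n)))
    (A : Set (EuclideanSpace ℝ (Fin n))) : Prop :=
  ∃ κ : ℝ≥0 → ℝ≥0, IsClassKInfty κ ∧
    ∀ (D : Set ℝ) (φ : ℝ → EuclideanSpace ℝ (Fin n)), IsSolution F D φ →
      ∀ t ∈ D, Metric.infNndist (φ t) A ≤ κ (Metric.infNndist (φ 0) A)

/-- Uniform global attractivity of `A` for `ẋ ∈ F x`. -/
def UniformlyGloballyAttractive {n : ℕ}
    (F : EuclideanSpace ℝ (Fin n) → Set (EuclideanSpace ℝ (Fin n)))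
    (A : Set (EuclideanSpace ℝ (Fin n))) : Prop :=
  (∀ (D : Set ℝ) (φ : ℝ → EuclideanSpace ℝ (Fin n)), IsMaximalSolution F D φ →
      IsCompleteDomain D) ∧
    ∀ ε > (0 : ℝ), ∀ μ > (0 : ℝ), ∃ T > (0 : ℝ),
      ∀ (D : Set ℝ) (φ : ℝ → EuclideanSpace ℝ (Fin n)), IsSolution F D φ →
        Metric.infDist (φ 0) A ≤ μ → ∀ t ∈ D, T ≤ t → Metric.infDist (φ t) A ≤ ε

/-- Uniform global asymptotic stability of a (nonempty, closed) set `A` for `ẋ ∈ F x`. -/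
structure UGAS {n : ℕ} (F : EuclideanSpace ℝ (Fin n) → Set (EuclideanSpace ℝ (Fin n)))
    (A : Set (EuclideanSpace ℝ (Fin n))) : Prop where
  nonempty : A.Nonempty
  isClosed : IsClosed A
  stable : GloballyUniformlyStable F A
  attractive : UniformlyGloballyAttractive F A

end DiffIncl

/-!
Write `A` for the complement of the interior of `{x | α ≤ V x}`. Since `F` has nonempty values, the
decrease condition forbids critical points of `V` in `{x | α ≤ V x}`. Hence `A` equals the compact
sublevel set `{x | V x ≤ α}`, and it contains every global minimum of `V`.

Along a solution `φ` the composition `V ∘ φ` is absolutely continuous, so the fundamental theorem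
of calculus turns the decrease condition into
`V (φ t) ≤ max α (exp (-ρ * t) * V (φ 0))` (`IsSolution.le_max_exp_mul`). By compactness of
sublevel sets, smallness of the distance to `A` and smallness of `V - α` control each other. This
gives uniform attractivity, and a modulus of stability, which is replaced by a majorant of class
`𝒦∞` (`exists_isClassKInfty_ge`).

Completeness of maximal solutions needs an existence theorem. A solution stays in a sublevel set of
`V`, where `F` is bounded, so it is Lipschitz; if its domain is bounded, it has a limit at the right
end, and a local solution starting at the limit extends it (`IsMaximalSolution.isCompleteDomain`).
Local solutions are limits of Euler approximations for an arbitrary selection of `F`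
(`exists_limit_eulerStep`). The limit `x` is Lipschitz, hence differentiable almost everywhere. By
upper semicontinuity and convexity, its short difference quotients at `t` lie in any prescribed
closed thickening of `F (x t)`, and so its derivative lies in the closed set `F (x t)`
(`BasicConditions.exists_local_solution`).
-/

namespace DiffIncl

open Set Filter MeasureTheory

/-! ### Absolutely continuous curves -/

/-- An absolutely continuous function whose derivative is almost everywhere nonpositive
does not increase. -/
lemma le_of_ae_deriv_nonpos {g : ℝ → ℝ} {a b : ℝ} (hab : a ≤ b)
    (hg : AbsolutelyContinuousOnInterval g a b)
    (h : ∀ᵐ t : ℝ, t ∈ Ioo a b → deriv g t ≤ 0) : g b ≤ g a := by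
  have h1 : ∫ t in a..b, deriv g t ≤ 0 := by
    rw [intervalIntegral.integral_of_le hab, integral_Ioc_eq_integral_Ioo]
    exact setIntegral_nonpos_of_ae_restrict ((ae_restrict_iff' measurableSet_Ioo).2 h)
  rw [hg.integral_deriv_eq_sub] at h1
  linarith

lemma _root_.LipschitzOnWith.comp_absolutelyContinuousOnInterval {X Y : Type*}
    [PseudoMetricSpace X] [PseudoMetricSpace Y] {K : ℝ≥0} {f : X → Y} {s : Set X} {φ : ℝ → X}
    {a b : ℝ} (hf : LipschitzOnWith K f s) (hφ : AbsolutelyContinuousOnInterval φ a b)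
    (hs : MapsTo φ (uIcc a b) s) : AbsolutelyContinuousOnInterval (f ∘ φ) a b := by
  have hK : Tendsto (fun E : ℕ × (ℕ → ℝ × ℝ) ↦
      (K : ℝ) * ∑ i ∈ Finset.range E.1, dist (φ (E.2 i).1) (φ (E.2 i).2))
      (AbsolutelyContinuousOnInterval.totalLengthFilter ⊓
        𝓟 (AbsolutelyContinuousOnInterval.disjWithin a b)) (𝓝 0) := by
    simpa using Tendsto.const_mul (K : ℝ) (id hφ : Tendsto _ _ _)
  refine squeeze_zero' (Eventually.of_forall fun E ↦ Finset.sum_nonneg fun i _ ↦ dist_nonneg)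
    ?_ hK
  filter_upwards [mem_inf_of_right (mem_principal_self _)] with E hE
  rw [Finset.mul_sum]
  exact Finset.sum_le_sum fun i hi ↦
    hf.dist_le_mul _ (hs (hE.1 i hi).1) _ (hs (hE.1 i hi).2)

section Curves

variable {E : Type*} [NormedAddCommGroup E] [InnerProductSpace ℝ E]

lemma _root_.ContDiff.comp_absolutelyContinuousOnInterval [FiniteDimensional ℝ E] {V : E → ℝ}
    (hV : ContDiff ℝ 1 V) {φ : ℝ → E} {a b : ℝ} (hφ : AbsolutelyContinuousOnInterval φ a b) :
    AbsolutelyContinuousOnInterval (V ∘ φ) a b := by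
  obtain ⟨C, hC⟩ := hφ.exists_bound
  obtain ⟨K, hK⟩ := (hV.contDiffOn (s := Metric.closedBall 0 C)).exists_lipschitzOnWith
    one_ne_zero (convex_closedBall _ _) (isCompact_closedBall _ _)
  exact hK.comp_absolutelyContinuousOnInterval hφ fun t ht ↦ by simpa using hC t ht

/-- Mean value inequality for an absolutely continuous curve whose speed is almost everywhere
at most `M`. -/
lemma norm_sub_le_of_ae_speed_le {φ : ℝ → E} {a b M : ℝ} (hab : a ≤ b)
    (hφ : AbsolutelyContinuousOnInterval φ a b)
    (h : ∀ᵐ t : ℝ, t ∈ Ioo a b → ∃ v, ‖v‖ ≤ M ∧ HasDerivAt φ v t) :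
    ‖φ b - φ a‖ ≤ M * (b - a) := by
  set w := φ b - φ a with hw
  rcases eq_or_ne w 0 with h0 | h0
  · rcases hab.eq_or_lt with rfl | hlt
    · simp [h0]
    · obtain ⟨t, ht, htab⟩ : ∃ t, (t ∈ Ioo a b → ∃ v, ‖v‖ ≤ M ∧ HasDerivAt φ v t) ∧
          t ∈ Ioo a b := by
        have : ∃ᵐ t : ℝ, t ∈ Ioo a b := by
          rw [frequently_ae_mem_iff]
          simp [hlt]
        exact (this.and_eventually h).exists.imp fun t ht ↦ ⟨ht.2, ht.1⟩
      obtain ⟨v, hv, -⟩ := ht htab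
      rw [h0, norm_zero]
      exact mul_nonneg ((norm_nonneg v).trans hv) (by linarith)
  -- The increment of `φ` is tested against its own direction `w`.
  have hlip : LipschitzOnWith ‖innerSL ℝ w‖₊ (fun y ↦ inner ℝ w y) univ :=
    (innerSL ℝ w).lipschitz.lipschitzOnWith
  have h1 : AbsolutelyContinuousOnInterval (fun t ↦ inner ℝ w (φ t)) a b :=
    hlip.comp_absolutelyContinuousOnInterval hφ fun _ _ ↦ mem_univ _
  have h2 : AbsolutelyContinuousOnInterval (fun t : ℝ ↦ ‖w‖ * M * t) a b :=
    ContDiffOn.absolutelyContinuousOnInterval (by fun_prop)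
  have h3 := le_of_ae_deriv_nonpos hab (h1.sub h2) (by
    filter_upwards [h] with t ht htab
    obtain ⟨v, hv, hd⟩ := ht htab
    have e1 : HasDerivAt (fun t ↦ inner ℝ w (φ t)) (inner ℝ w v) t :=
      (innerSL ℝ w).hasFDerivAt.comp_hasDerivAt t hd
    have e2 : HasDerivAt (fun t : ℝ ↦ ‖w‖ * M * t) (‖w‖ * M) t := by
      simpa using (hasDerivAt_id t).const_mul (‖w‖ * M)
    rw [(e1.sub e2).deriv]
    have := real_inner_le_norm w v
    have := mul_le_mul_of_nonneg_left hv (norm_nonneg w)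
    linarith)
  simp only [Pi.sub_apply] at h3
  have h4 : ‖w‖ * ‖w‖ ≤ ‖w‖ * (M * (b - a)) := by
    rw [← real_inner_self_eq_norm_mul_norm]
    nth_rewrite 2 [hw]
    rw [inner_sub_right]
    linarith
  exact le_of_mul_le_mul_left h4 (norm_pos_iff.2 h0)

end Curves

/-! ### Euler approximations and their limits -/

section Euler

variable {E : Type*} [NormedAddCommGroup E] [NormedSpace ℝ E]

/-- The nodes of the explicit Euler scheme with step size `h` for `ẋ = f x`. -/
def eulerNode (f : E → E) (h : ℝ) (x₀ : E) : ℕ → E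
  | 0 => x₀
  | j + 1 => eulerNode f h x₀ j + h • f (eulerNode f h x₀ j)

lemma eulerNode_add_sub (f : E → E) (h : ℝ) (x₀ : E) (i m : ℕ) :
    eulerNode f h x₀ (i + m) - eulerNode f h x₀ i =
      h • ∑ j ∈ Finset.range m, f (eulerNode f h x₀ (i + j)) := by
  induction m with
  | zero => simp
  | succ m ih =>
    rw [Finset.sum_range_succ, smul_add, ← ih, ← add_assoc, eulerNode]
    abel

lemma norm_eulerNode_add_sub_le {f : E → E} {M : ℝ} (hf : ∀ z, ‖f z‖ ≤ M) {h : ℝ} (hh : 0 ≤ h)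
    (x₀ : E) (i m : ℕ) :
    ‖eulerNode f h x₀ (i + m) - eulerNode f h x₀ i‖ ≤ M * (m * h) := by
  rw [eulerNode_add_sub, norm_smul, Real.norm_of_nonneg hh]
  have := norm_sum_le_of_le (Finset.range m)
    (fun j _ ↦ hf (eulerNode f h x₀ (i + j)))
  rw [Finset.sum_const, Finset.card_range, nsmul_eq_mul] at this
  calc _ ≤ h * (m * M) := mul_le_mul_of_nonneg_left this hh
    _ = _ := by ring

/-- The piecewise constant Euler approximation with step size `1 / (k + 1)`. For negative times
it takes the initial value. -/
noncomputable def eulerStep (f : E → E) (x₀ : E) (k : ℕ) (t : ℝ) : E :=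
  eulerNode f (1 / ((k : ℝ) + 1)) x₀ ⌊t * ((k : ℝ) + 1)⌋₊

lemma floor_sub_floor_mul_le {s t : ℝ} (hst : s ≤ t) (k : ℕ) :
    ((⌊t * ((k : ℝ) + 1)⌋₊ - ⌊s * ((k : ℝ) + 1)⌋₊ : ℕ) : ℝ) * (1 / ((k : ℝ) + 1)) ≤
      t - s + 1 / ((k : ℝ) + 1) := by
  have hk : (0 : ℝ) < k + 1 := by positivity
  have hle : ⌊s * ((k : ℝ) + 1)⌋₊ ≤ ⌊t * ((k : ℝ) + 1)⌋₊ := by gcongr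
  rw [Nat.cast_sub hle, mul_one_div, div_le_iff₀ hk]
  have e : (t - s + 1 / ((k : ℝ) + 1)) * (k + 1) = t * (k + 1) - s * (k + 1) + 1 := by
    field_simp
  rw [e]
  rcases lt_or_ge t 0 with ht | ht
  · rw [Nat.floor_of_nonpos (by nlinarith), Nat.floor_of_nonpos (by nlinarith)]
    nlinarith
  · have := Nat.floor_le (a := t * ((k : ℝ) + 1)) (by positivity)
    have := Nat.lt_floor_add_one (s * ((k : ℝ) + 1))
    linarith

lemma norm_eulerStep_sub_le {f : E → E} {M : ℝ} (hf : ∀ z, ‖f z‖ ≤ M) (x₀ : E) (k : ℕ)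
    {s t : ℝ} (hst : s ≤ t) :
    ‖eulerStep f x₀ k t - eulerStep f x₀ k s‖ ≤ M * (t - s + 1 / ((k : ℝ) + 1)) := by
  have hk : (0 : ℝ) < k + 1 := by positivity
  have hM : 0 ≤ M := (norm_nonneg _).trans (hf 0)
  have hle : ⌊s * ((k : ℝ) + 1)⌋₊ ≤ ⌊t * ((k : ℝ) + 1)⌋₊ := by gcongr
  have := norm_eulerNode_add_sub_le hf (h := 1 / ((k : ℝ) + 1)) (by positivity) x₀
    ⌊s * ((k : ℝ) + 1)⌋₊ (⌊t * ((k : ℝ) + 1)⌋₊ - ⌊s * ((k : ℝ) + 1)⌋₊)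
  rw [Nat.add_sub_cancel' hle] at this
  exact this.trans (mul_le_mul_of_nonneg_left (floor_sub_floor_mul_le hst k) hM)

/-- Euler approximations of a bounded, possibly discontinuous, vector field `f` have a Lipschitz
limit `x` along an ultrafilter. The difference quotients of `x` lie in every closed convex set that
contains the values of `f` near the corresponding point. Pointwise convergence suffices for this,
since the approximations share the modulus of continuity `M * (h + 1 / (k + 1))`. -/
lemma exists_limit_eulerStep [FiniteDimensional ℝ E] {f : E → E} {M : ℝ≥0}
    (hf : ∀ z, ‖f z‖ ≤ M) (x₀ : E) :
    ∃ x : ℝ → E, LipschitzWith M x ∧ (∀ t ≤ 0, x t = x₀) ∧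
      ∀ t ≥ 0, ∀ r : ℝ, ∀ C : Set E, IsClosed C → Convex ℝ C →
        (∀ z ∈ Metric.ball (x t) r, f z ∈ C) →
        ∀ h > 0, M * h < r → h⁻¹ • (x (t + h) - x t) ∈ C := by
  have : ProperSpace E := FiniteDimensional.proper ℝ E
  let U : Ultrafilter ℕ := hyperfilter ℕ
  have hU : (U : Filter ℕ) ≤ atTop := Nat.hyperfilter_le_atTop
  have hone : Tendsto (fun k : ℕ ↦ 1 / ((k : ℝ) + 1)) U (𝓝 0) :=
    tendsto_one_div_add_atTop_nhds_zero_nat.mono_left hU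
  have hlim : ∀ t, ∃ y, Tendsto (fun k ↦ eulerStep f x₀ k t) U (𝓝 y) := by
    intro t
    have hmem : ∀ k, eulerStep f x₀ k t ∈ Metric.closedBall x₀ (M * (|t| + 1)) := by
      intro k
      have h0 : eulerStep f x₀ k (min t 0) = x₀ := by
        have : min t 0 * ((k : ℝ) + 1) ≤ 0 :=
          mul_nonpos_of_nonpos_of_nonneg (min_le_right _ _) (by positivity)
        simp [eulerStep, Nat.floor_of_nonpos this, eulerNode]
      have h1 := norm_eulerStep_sub_le hf x₀ k (min_le_left t 0)
      rw [h0] at h1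
      rw [mem_closedBall_iff_norm]
      refine h1.trans (mul_le_mul_of_nonneg_left ?_ M.2)
      have h2 : 1 / ((k : ℝ) + 1) ≤ 1 := by
        rw [div_le_one (by positivity)]
        have : (0 : ℝ) ≤ k := by positivity
        linarith
      have h3 : t - min t 0 ≤ |t| := by
        rcases le_total t 0 with h | h
        · simp [h]
        · simp [h, le_abs_self]
      linarith
    obtain ⟨y, -, hy⟩ := (isCompact_closedBall x₀ (M * (|t| + 1))).ultrafilter_le_nhds
      (U.map fun k ↦ eulerStep f x₀ k t)
      (by
        rw [le_principal_iff, Ultrafilter.mem_coe, Ultrafilter.mem_map]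
        exact Filter.univ_mem' hmem)
    exact ⟨y, hy⟩
  choose x hx using hlim
  have hdist : ∀ s t, s ≤ t → ‖x t - x s‖ ≤ M * (t - s) := by
    intro s t hst
    have h2 : Tendsto (fun k : ℕ ↦ (M : ℝ) * (t - s + 1 / ((k : ℝ) + 1))) U
        (𝓝 (M * (t - s))) := by
      simpa using (hone.const_add (t - s)).const_mul (M : ℝ)
    exact le_of_tendsto_of_tendsto ((hx t).sub (hx s)).norm h2
      (Eventually.of_forall fun k ↦ norm_eulerStep_sub_le hf x₀ k hst)
  refine ⟨x, ?_, ?_, ?_⟩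
  · refine LipschitzWith.of_dist_le_mul fun s t ↦ ?_
    rcases le_total s t with h | h
    · rw [dist_comm, dist_eq_norm, Real.dist_eq, abs_sub_comm, abs_of_nonneg (sub_nonneg.2 h)]
      exact hdist s t h
    · rw [dist_eq_norm, Real.dist_eq, abs_of_nonneg (sub_nonneg.2 h)]
      exact hdist t s h
  · intro t ht
    refine tendsto_nhds_unique (hx t) (tendsto_const_nhds.congr fun k ↦ ?_)
    have : t * ((k : ℝ) + 1) ≤ 0 := mul_nonpos_of_nonpos_of_nonneg ht (by positivity)
    simp [eulerStep, Nat.floor_of_nonpos this, eulerNode]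
  · intro t ht r C hC hCc hfC h hh hr
    have hk1 : Tendsto (fun k : ℕ ↦ (k : ℝ) + 1) U atTop :=
      (tendsto_natCast_atTop_atTop.atTop_add tendsto_const_nhds).mono_left hU
    have hfl : Tendsto (fun k : ℕ ↦
        (⌊(t + h) * ((k : ℝ) + 1)⌋₊ : ℝ) / ((k : ℝ) + 1) -
          (⌊t * ((k : ℝ) + 1)⌋₊ : ℝ) / ((k : ℝ) + 1)) U (𝓝 h) := by
      have h1 := (tendsto_nat_floor_mul_div_atTop (R := ℝ) (by linarith : 0 ≤ t + h)).comp hk1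
      have h2 := (tendsto_nat_floor_mul_div_atTop (R := ℝ) ht).comp hk1
      simpa using h1.sub h2
    have hconv := (hfl.inv₀ hh.ne').smul ((hx (t + h)).sub (hx t))
    refine hC.mem_of_tendsto hconv ?_
    have hrad : Tendsto (fun k : ℕ ↦ (M : ℝ) * (h + 1 / ((k : ℝ) + 1)) +
        dist (eulerStep f x₀ k t) (x t)) U (𝓝 (M * h)) := by
      simpa using ((hone.const_add h).const_mul (M : ℝ)).add
        ((hx t).dist (tendsto_const_nhds (x := x t)))
    filter_upwards [hrad.eventually_lt_const hr, hfl.eventually_const_lt hh] with k hk hpos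
    have hk0 : (0 : ℝ) < k + 1 := by positivity
    have hle : ⌊t * ((k : ℝ) + 1)⌋₊ ≤ ⌊(t + h) * ((k : ℝ) + 1)⌋₊ := by
      gcongr
      linarith
    obtain ⟨m, hm⟩ := Nat.exists_eq_add_of_le hle
    have hbound := floor_sub_floor_mul_le (by linarith : t ≤ t + h) k
    rw [hm, Nat.add_sub_cancel_left] at hbound
    simp only [add_sub_cancel_left] at hbound
    rw [← sub_div, hm] at hpos
    rw [← sub_div]
    simp only [eulerStep, hm] at hk ⊢
    rw [eulerNode_add_sub]
    push_cast at hpos ⊢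
    rw [add_sub_cancel_left] at hpos ⊢
    have hm0 : (0 : ℝ) < m := by
      by_contra hcon
      have : (m : ℝ) / (k + 1) ≤ 0 := div_nonpos_of_nonpos_of_nonneg (not_lt.1 hcon) hk0.le
      linarith
    -- The quotient is the mean of the `m` values of `f` at the nodes visited on the way.
    rw [smul_smul, show ((m : ℝ) / (k + 1))⁻¹ * (1 / ((k : ℝ) + 1)) = (m : ℝ)⁻¹ by
      field_simp, Finset.smul_sum]
    refine hCc.sum_mem (fun _ _ ↦ by positivity) ?_ fun j hj ↦ hfC _ ?_
    · simp [hm0.ne']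
    · rw [Metric.mem_ball]
      refine lt_of_le_of_lt (dist_triangle _
        (eulerNode f (1 / ((k : ℝ) + 1)) x₀ ⌊t * ((k : ℝ) + 1)⌋₊) _) (lt_of_le_of_lt ?_ hk)
      gcongr
      rw [dist_eq_norm]
      refine (norm_eulerNode_add_sub_le hf (by positivity) x₀ _ j).trans
        (mul_le_mul_of_nonneg_left (le_trans ?_ hbound) M.2)
      gcongr
      exact (Finset.mem_range.1 hj).le

end Euler

/-! ### Local existence of solutions -/

section Existence

variable {n : ℕ} {F : EuclideanSpace ℝ (Fin n) → Set (EuclideanSpace ℝ (Fin n))}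

lemma OuterSemicontinuous.isClosed (hF : OuterSemicontinuous F) (x : EuclideanSpace ℝ (Fin n)) :
    IsClosed (F x) :=
  IsSeqClosed.isClosed fun w y hw hy ↦ hF x y (fun _ ↦ x) w tendsto_const_nhds hw hy

/-- For locally bounded maps, outer semicontinuity implies upper semicontinuity. -/
lemma BasicConditions.exists_ball_subset_cthickening (hF : BasicConditions F)
    (x : EuclideanSpace ℝ (Fin n)) {ε : ℝ} (hε : 0 < ε) :
    ∃ δ > 0, ∀ z ∈ Metric.ball x δ, F z ⊆ Metric.cthickening ε (F x) := by
  by_contra! hcon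
  have hpos : ∀ k : ℕ, (0 : ℝ) < 1 / ((k : ℝ) + 1) := fun k ↦ by positivity
  have hex : ∀ k : ℕ, ∃ z y, z ∈ Metric.ball x (1 / ((k : ℝ) + 1)) ∧ y ∈ F z ∧
      y ∉ Metric.cthickening ε (F x) := by
    intro k
    obtain ⟨z, hz, hnot⟩ := hcon _ (hpos k)
    obtain ⟨y, hy, hy'⟩ := not_subset.1 hnot
    exact ⟨z, y, hz, hy, hy'⟩
  choose z y hz hy hy' using hex
  have hzx : Tendsto z atTop (𝓝 x) := by
    rw [tendsto_iff_dist_tendsto_zero]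
    exact squeeze_zero (fun _ ↦ dist_nonneg) (fun k ↦ (Metric.mem_ball.1 (hz k)).le)
      tendsto_one_div_add_atTop_nhds_zero_nat
  obtain ⟨U, hU, hUb⟩ := hF.locallyBounded x
  obtain ⟨w, -, ψ, hψ, hw⟩ := tendsto_subseq_of_frequently_bounded hUb (x := y)
    ((hzx.eventually hU).mono fun k hk ↦ mem_iUnion₂.2 ⟨z k, hk, hy k⟩).frequently
  have hwF : w ∈ F x := hF.outerSemicontinuous x w (z ∘ ψ) (y ∘ ψ)
    (hzx.comp hψ.tendsto_atTop) (fun i ↦ hy _) hw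
  have hnhds : Metric.cthickening ε (F x) ∈ 𝓝 w :=
    mem_of_superset (Metric.ball_mem_nhds w hε) fun v hv ↦
      Metric.mem_cthickening_of_dist_le v w ε _ hwF (Metric.mem_ball.1 hv).le
  obtain ⟨k, hk⟩ := (hw.eventually hnhds).exists
  exact hy' _ hk

lemma LocallyBounded.exists_bound_of_isCompact (hF : LocallyBounded F)
    {K : Set (EuclideanSpace ℝ (Fin n))} (hK : IsCompact K) :
    ∃ M : ℝ≥0, ∀ z ∈ K, ∀ f ∈ F z, ‖f‖ ≤ M := by
  have hb : Bornology.IsBounded (⋃ z ∈ K, F z) := by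
    refine hK.induction_on (p := fun s ↦ Bornology.IsBounded (⋃ z ∈ s, F z)) (by simp)
      (fun s t hst ht ↦ ht.subset (biUnion_subset_biUnion_left hst))
      (fun s t hs ht ↦ ?_) fun x _ ↦ ?_
    · rw [biUnion_union]
      exact hs.union ht
    · obtain ⟨U, hU, hUb⟩ := hF x
      exact ⟨U, mem_nhdsWithin_of_mem_nhds hU, hUb⟩
  obtain ⟨M, hM⟩ := hb.exists_norm_le
  exact ⟨M.toNNReal, fun z hz f hf ↦
    (hM f (mem_iUnion₂.2 ⟨z, hz, hf⟩)).trans (Real.le_coe_toNNReal M)⟩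

/-- Under the basic conditions there is a Lipschitz solution on a short time interval. It is
extended to all of `ℝ` by a Lipschitz curve which is constant for negative times. -/
lemma BasicConditions.exists_local_solution (hF : BasicConditions F)
    (x₀ : EuclideanSpace ℝ (Fin n)) :
    ∃ τ > (0 : ℝ), ∃ M : ℝ≥0, ∃ x : ℝ → EuclideanSpace ℝ (Fin n), LipschitzWith M x ∧
      (∀ t ≤ 0, x t = x₀) ∧ ∀ᵐ t : ℝ, t ∈ Ioo 0 τ → ∃ v ∈ F (x t), HasDerivAt x v t := by
  obtain ⟨M, hM⟩ := hF.locallyBounded.exists_bound_of_isCompact (isCompact_closedBall x₀ 1)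
  choose sel hsel using hF.nonempty
  classical
  -- Truncation outside a ball makes the selection globally bounded.
  let f : EuclideanSpace ℝ (Fin n) → EuclideanSpace ℝ (Fin n) :=
    fun z ↦ if z ∈ Metric.ball x₀ 1 then sel z else 0
  have hf : ∀ z, ‖f z‖ ≤ M := by
    intro z
    by_cases hz : z ∈ Metric.ball x₀ 1
    · simpa only [f, hz, if_true] using hM z (Metric.ball_subset_closedBall hz) _ (hsel z)
    · simp only [f, hz, if_false, norm_zero, NNReal.coe_nonneg]
  obtain ⟨x, hlip, hneg, hmv⟩ := exists_limit_eulerStep hf x₀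
  refine ⟨1 / (M + 1), by positivity, M, x, hlip, hneg, ?_⟩
  filter_upwards [hlip.ae_differentiableAt_real] with t hdiff ht
  have hball : x t ∈ Metric.ball x₀ 1 := by
    rw [Metric.mem_ball, ← hneg 0 le_rfl]
    refine (hlip.dist_le_mul t 0).trans_lt ?_
    have h1 := ht.2
    rw [lt_div_iff₀ (by positivity)] at h1
    rw [Real.dist_eq, sub_zero, abs_of_pos ht.1]
    linarith [ht.1]
  refine ⟨deriv x t, ?_, hdiff.hasDerivAt⟩
  rw [← (hF.outerSemicontinuous.isClosed (x t)).closure_eq, Metric.closure_eq_iInter_cthickening]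
  refine mem_iInter₂.2 fun ε hε ↦ ?_
  obtain ⟨δ, hδ, hsub⟩ := hF.exists_ball_subset_cthickening (x t) hε
  obtain ⟨r, hr, hrsub⟩ := Metric.isOpen_ball.mem_nhds hball |> Metric.mem_nhds_iff.1
  have hC : ∀ z ∈ Metric.ball (x t) (min δ r), f z ∈ Metric.cthickening ε (F (x t)) := by
    intro z hz
    have hz1 : z ∈ Metric.ball x₀ 1 :=
      hrsub (Metric.ball_subset_ball (min_le_right _ _) hz)
    simpa only [f, hz1, if_true] using
      hsub z (Metric.ball_subset_ball (min_le_left _ _) hz) (hsel z)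
  -- Difference quotients with small positive step lie in the thickening, hence so does their limit.
  have hslope := hdiff.hasDerivAt.tendsto_slope_zero_right
  refine Metric.isClosed_cthickening.mem_of_tendsto hslope ?_
  have hsmall : Tendsto (fun h : ℝ ↦ (M : ℝ) * h) (𝓝[>] 0) (𝓝 0) := by
    have : Tendsto (fun h : ℝ ↦ (M : ℝ) * h) (𝓝 0) (𝓝 (M * 0)) := tendsto_id.const_mul _
    rw [mul_zero] at this
    exact this.mono_left nhdsWithin_le_nhds
  filter_upwards [self_mem_nhdsWithin, hsmall.eventually_lt_const (lt_min hδ hr)] with h h0 hlt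
  exact hmv t ht.1.le _ _ Metric.isClosed_cthickening ((hF.convex (x t)).cthickening ε) hC h h0 hlt

end Existence

/-! ### Continuation of solutions -/

section Continuation

variable {n : ℕ} {F : EuclideanSpace ℝ (Fin n) → Set (EuclideanSpace ℝ (Fin n))}
  {D : Set ℝ} {φ : ℝ → EuclideanSpace ℝ (Fin n)}

lemma IsSolution.Icc_subset (hφ : IsSolution F D φ) {s t : ℝ} (hs : 0 ≤ s) (ht : t ∈ D) :
    Icc s t ⊆ D :=
  (Icc_subset_Icc_left hs).trans (hφ.ordConnected.out hφ.zero_mem ht)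

lemma IsSolution.ae_hasDerivAt (hφ : IsSolution F D φ) {s t : ℝ} (hs : 0 ≤ s) (ht : t ∈ D) :
    ∀ᵐ u : ℝ, u ∈ Ioo s t → ∃ v ∈ F (φ u), HasDerivAt φ v u := by
  filter_upwards [hφ.deriv_mem] with u hu hust
  have hsub := hφ.Icc_subset hs ht
  obtain ⟨v, hv, hd⟩ := hu (hsub (Ioo_subset_Icc_self hust))
  exact ⟨v, hv, hd.hasDerivAt (mem_of_superset (Icc_mem_nhds hust.1 hust.2) hsub)⟩

/-- A solution which stays in a compact set is Lipschitz. -/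
lemma IsSolution.exists_lipschitzOnWith (hF : BasicConditions F) (hφ : IsSolution F D φ)
    {K : Set (EuclideanSpace ℝ (Fin n))} (hK : IsCompact K) (hmem : MapsTo φ D K) :
    ∃ M : ℝ≥0, LipschitzOnWith M φ D := by
  obtain ⟨M, hM⟩ := hF.locallyBounded.exists_bound_of_isCompact hK
  have key : ∀ s ∈ D, ∀ t ∈ D, s ≤ t → ‖φ t - φ s‖ ≤ M * (t - s) := by
    intro s hs t ht hst
    refine norm_sub_le_of_ae_speed_le hst (hφ.absolutelyContinuous s hs t ht) ?_
    filter_upwards [hφ.ae_hasDerivAt (hφ.nonneg s hs) ht] with u hu hust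
    obtain ⟨v, hv, hd⟩ := hu hust
    exact ⟨v, hM _ (hmem (hφ.Icc_subset (hφ.nonneg s hs) ht (Ioo_subset_Icc_self hust))) v hv, hd⟩
  refine ⟨M, LipschitzOnWith.of_dist_le_mul fun s hs t ht ↦ ?_⟩
  rcases le_total s t with h | h
  · rw [dist_comm, dist_eq_norm, Real.dist_eq, abs_sub_comm, abs_of_nonneg (sub_nonneg.2 h)]
    exact key s hs t ht h
  · rw [dist_eq_norm, Real.dist_eq, abs_of_nonneg (sub_nonneg.2 h)]
    exact key t ht s hs h

/-- A maximal solution which stays in a compact set is complete: otherwise it has a limit at the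
end of its domain, where a local solution can be attached. -/
lemma IsMaximalSolution.isCompleteDomain (hF : BasicConditions F) (hφ : IsMaximalSolution F D φ)
    {K : Set (EuclideanSpace ℝ (Fin n))} (hK : IsCompact K) (hmem : MapsTo φ D K) :
    IsCompleteDomain D := by
  obtain ⟨hsol, hmax⟩ := hφ
  intro hbdd
  apply hmax
  obtain ⟨M, hM⟩ := hsol.exists_lipschitzOnWith hF hK hmem
  obtain ⟨g, hg, hgφ⟩ := hM.extend_finite_dimension
  set b := sSup D with hb
  have hDb : ∀ t ∈ D, t ≤ b := fun t ht ↦ le_csSup hbdd ht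
  have hb0 : 0 ≤ b := hDb 0 hsol.zero_mem
  have hIco : ∀ t, 0 ≤ t → t < b → t ∈ D := by
    intro t h0 htb
    obtain ⟨s, hs, hts⟩ := exists_lt_of_lt_csSup ⟨0, hsol.zero_mem⟩ htb
    exact hsol.ordConnected.out hsol.zero_mem hs ⟨h0, hts.le⟩
  obtain ⟨τ, hτ, N, x, hx, hx0, hxF⟩ := hF.exists_local_solution (g b)
  -- `χ` follows `g` up to time `b` and `x` afterwards; written as a sum, it is visibly Lipschitz.
  let χ : ℝ → EuclideanSpace ℝ (Fin n) := fun t ↦ g (min t b) + (x (t - b) - g b)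
  have hχ1 : ∀ t ≤ b, χ t = g t := by
    intro t ht
    simp [χ, min_eq_left ht, hx0 (t - b) (by linarith)]
  have hχ2 : ∀ t, b ≤ t → χ t = x (t - b) := by
    intro t ht
    simp [χ, min_eq_right ht]
  obtain ⟨C, hC⟩ : ∃ C, LipschitzWith C χ :=
    ⟨_, (hg.comp (LipschitzWith.id.min_const b)).add
      ((hx.comp (LipschitzWith.id.sub (LipschitzWith.const b))).sub (LipschitzWith.const (g b)))⟩
  refine ⟨Icc 0 (b + τ / 2), χ, ⟨ordConnected_Icc, fun t ht ↦ ht.1, ⟨le_rfl, by linarith⟩,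
    fun s _ t _ ↦ (hC.lipschitzOnWith).absolutelyContinuousOnInterval, ?_⟩, ?_, ?_⟩
  · have hshift : ∀ᵐ t : ℝ, t - b ∈ Ioo 0 τ → ∃ v ∈ F (x (t - b)), HasDerivAt x v (t - b) :=
      (measurePreserving_sub_right volume b).quasiMeasurePreserving.ae hxF
    have hne : ∀ c : ℝ, ∀ᵐ t : ℝ, t ≠ c := fun c ↦ by simp [ae_iff]
    filter_upwards [hsol.deriv_mem, hshift, hne 0, hne b] with t h1 h2 h0 hbt ht
    rcases lt_or_gt_of_ne hbt with hlt | hgt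
    · have htD := hIco t ht.1 hlt
      obtain ⟨v, hv, hd⟩ := h1 htD
      have hev : χ =ᶠ[𝓝 t] φ := by
        filter_upwards [Ioo_mem_nhds (lt_of_le_of_ne ht.1 h0.symm) hlt] with s hs
        rw [hχ1 s hs.2.le, hgφ (hIco s hs.1.le hs.2)]
      have hD : D ∈ 𝓝 t := mem_of_superset
        (Ioo_mem_nhds (lt_of_le_of_ne ht.1 h0.symm) hlt) fun s hs ↦ hIco s hs.1.le hs.2
      refine ⟨v, ?_, ((hd.hasDerivAt hD).congr_of_eventuallyEq hev).hasDerivWithinAt⟩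
      rwa [hev.eq_of_nhds]
    · obtain ⟨v, hv, hd⟩ := h2 ⟨by linarith, by linarith [ht.2]⟩
      have hev : χ =ᶠ[𝓝 t] fun s ↦ x (s - b) := by
        filter_upwards [Ioi_mem_nhds hgt] with s hs
        exact hχ2 s (le_of_lt hs)
      refine ⟨v, ?_, ((hd.comp_sub_const t b).congr_of_eventuallyEq hev).hasDerivWithinAt⟩
      rwa [hev.eq_of_nhds]
  · refine ⟨fun t ht ↦ ⟨hsol.nonneg t ht, by linarith [hDb t ht]⟩, fun hsub ↦ ?_⟩
    have := hDb _ (hsub (right_mem_Icc.2 (by linarith)))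
    linarith
  · intro t ht
    rw [hχ1 t (hDb t ht), hgφ ht]

end Continuation

/-! ### Majorants of class `𝒦∞` -/

/-- A monotone function which tends to `0` at `0` has a majorant of class `𝒦∞`. The averages
`∫ u in 1..2, g (r * u)` are squeezed between `g r` and `g (2 * r)`, and away from `0` they depend
continuously on `r` because of the substitution `s = r * u`. -/
lemma exists_isClassKInfty_ge {g : ℝ → ℝ} (hg : Monotone g) (hg0 : g 0 = 0)
    (hlim : Tendsto g (𝓝[≥] 0) (𝓝 0)) :
    ∃ κ : ℝ≥0 → ℝ≥0, IsClassKInfty κ ∧ ∀ r : ℝ≥0, g r ≤ κ r := by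
  let h : ℝ → ℝ := fun r ↦ ∫ u in (1 : ℝ)..2, g (r * u)
  have hmono : ∀ {r : ℝ}, 0 ≤ r → Monotone fun u ↦ g (r * u) := fun hr _ _ huv ↦
    hg (mul_le_mul_of_nonneg_left huv hr)
  have hint : ∀ {r : ℝ}, 0 ≤ r → IntervalIntegrable (fun u ↦ g (r * u)) volume 1 2 :=
    fun hr ↦ (hmono hr).intervalIntegrable
  have hh_mono : ∀ {r s : ℝ}, 0 ≤ r → r ≤ s → h r ≤ h s := fun hr hrs ↦
    intervalIntegral.integral_mono_on one_le_two (hint hr) (hint (hr.trans hrs)) fun u hu ↦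
      hg (mul_le_mul_of_nonneg_right hrs (zero_le_one.trans hu.1))
  have hlow : ∀ {r : ℝ}, 0 ≤ r → g r ≤ h r := by
    intro r hr
    have := intervalIntegral.integral_mono_on one_le_two
      (intervalIntegrable_const (c := g r) (μ := volume)) (hint hr) fun u hu ↦
        hg (le_mul_of_one_le_right hr hu.1)
    simp only [intervalIntegral.integral_const, smul_eq_mul] at this
    linarith
  have hup : ∀ {r : ℝ}, 0 ≤ r → h r ≤ g (r * 2) := by
    intro r hr
    have := intervalIntegral.integral_mono_on one_le_two (hint hr)
      (intervalIntegrable_const (c := g (r * 2)) (μ := volume)) fun u hu ↦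
        hg (mul_le_mul_of_nonneg_left hu.2 hr)
    simp only [intervalIntegral.integral_const, smul_eq_mul] at this
    linarith
  have hg_nonneg : ∀ {r : ℝ}, 0 ≤ r → 0 ≤ g r := fun hr ↦ hg0 ▸ hg hr
  have hh0 : h 0 = 0 := by simp [h, hg0]
  have hcont : ContinuousOn h (Ici 0) := by
    intro r hr
    rcases (mem_Ici.1 hr).eq_or_lt with rfl | hpos
    · rw [ContinuousWithinAt, hh0]
      have h2 : Tendsto (fun r : ℝ ↦ g (r * 2)) (𝓝[≥] 0) (𝓝 0) := by
        refine hlim.comp (tendsto_nhdsWithin_iff.2 ⟨?_, ?_⟩)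
        · have : Tendsto (fun r : ℝ ↦ r * 2) (𝓝 0) (𝓝 (0 * 2)) := tendsto_id.mul_const _
          rw [zero_mul] at this
          exact this.mono_left nhdsWithin_le_nhds
        · filter_upwards [self_mem_nhdsWithin] with r hr
          exact mul_nonneg (mem_Ici.1 hr) zero_le_two
      refine tendsto_of_tendsto_of_tendsto_of_le_of_le' hlim h2 ?_ ?_
      · filter_upwards [self_mem_nhdsWithin] with r hr using hlow hr
      · filter_upwards [self_mem_nhdsWithin] with r hr using hup hr
    · have hprim : Continuous fun r : ℝ ↦ ∫ s in (0 : ℝ)..r, g s :=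
        intervalIntegral.continuous_primitive (fun _ _ ↦ hg.intervalIntegrable) 0
      have heq : (fun r : ℝ ↦ r⁻¹ * ((∫ s in (0 : ℝ)..r * 2, g s) - ∫ s in (0 : ℝ)..r, g s))
          =ᶠ[𝓝 r] h := by
        filter_upwards [lt_mem_nhds hpos] with s hs
        rw [intervalIntegral.integral_interval_sub_left hg.intervalIntegrable
          hg.intervalIntegrable]
        simp only [h]
        rw [intervalIntegral.integral_comp_mul_left g hs.ne', mul_one, smul_eq_mul]
      refine ContinuousAt.continuousWithinAt (ContinuousAt.congr ?_ heq)
      have h2 : Continuous fun r : ℝ ↦ ∫ s in (0 : ℝ)..r * 2, g s :=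
        hprim.comp (continuous_id.mul continuous_const)
      exact (continuousAt_inv₀ hpos.ne').mul (h2.sub hprim).continuousAt
  have hnn : ∀ r : ℝ≥0, 0 ≤ (r : ℝ) + h r := fun r ↦
    add_nonneg r.2 ((hg_nonneg r.2).trans (hlow r.2))
  have hκ : ∀ r : ℝ≥0, ((Real.toNNReal (r + h r) : ℝ≥0) : ℝ) = r + h r :=
    fun r ↦ Real.coe_toNNReal _ (hnn r)
  refine ⟨fun r ↦ Real.toNNReal (r + h r), ⟨?_, ?_, ?_, ?_⟩, fun r ↦ ?_⟩
  · exact continuous_real_toNNReal.comp (NNReal.continuous_coe.add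
      (hcont.comp_continuous NNReal.continuous_coe fun r ↦ r.2))
  · simp [hh0]
  · intro r s hrs
    rw [← NNReal.coe_lt_coe, hκ, hκ]
    exact add_lt_add_of_lt_of_le (NNReal.coe_lt_coe.2 hrs) (hh_mono r.2 hrs.le)
  · rintro ⟨B, hB⟩
    have h1 := NNReal.coe_le_coe.2 (hB ⟨B + 1, rfl⟩)
    have h2 := (hg_nonneg (B + 1).coe_nonneg).trans (hlow (B + 1).coe_nonneg)
    rw [hκ] at h1
    rw [NNReal.coe_add, NNReal.coe_one] at h1 h2
    linarith
  · rw [hκ]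
    linarith [hlow r.coe_nonneg, r.coe_nonneg]

/-- If `q` is bounded in terms of `p`, and small where `p` is small, then `q ≤ κ ∘ p` for some
function `κ` of class `𝒦∞`. -/
lemma exists_isClassKInfty_of_bounded_of_small {ι : Type*} {p q : ι → ℝ}
    (hbdd : ∀ r, ∃ B, ∀ i, p i ≤ r → q i ≤ B)
    (hsmall : ∀ ε > 0, ∃ δ > 0, ∀ i, p i ≤ δ → q i ≤ ε) :
    ∃ κ : ℝ≥0 → ℝ≥0, IsClassKInfty κ ∧ ∀ i, ∀ r : ℝ≥0, p i ≤ r → q i ≤ κ r := by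
  -- Inserting `0` keeps the suprema meaningful where no index qualifies.
  let S : ℝ → Set ℝ := fun r ↦ insert 0 (q '' {i | p i ≤ r})
  have hS : ∀ r, BddAbove (S r) := by
    intro r
    obtain ⟨B, hB⟩ := hbdd r
    refine BddAbove.insert _ ⟨B, ?_⟩
    rintro _ ⟨i, hi, rfl⟩
    exact hB i hi
  have hne : ∀ r, (S r).Nonempty := fun r ↦ insert_nonempty _ _
  let g : ℝ → ℝ := fun r ↦ sSup (S r)
  have hg : Monotone g := fun r s hrs ↦ csSup_le_csSup (hS s) (hne r)
    (insert_subset_insert (image_mono fun i hi ↦ le_trans hi hrs))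
  have hg_nonneg : ∀ r, 0 ≤ g r := fun r ↦ le_csSup (hS r) (mem_insert _ _)
  have hg_small : ∀ ε > 0, ∃ δ > 0, g δ ≤ ε := by
    intro ε hε
    obtain ⟨δ, hδ, h⟩ := hsmall ε hε
    refine ⟨δ, hδ, csSup_le (hne δ) ?_⟩
    rintro _ (rfl | ⟨i, hi, rfl⟩)
    · exact hε.le
    · exact h i hi
  have hg0 : g 0 = 0 := by
    refine le_antisymm (le_of_forall_pos_le_add fun ε hε ↦ ?_) (hg_nonneg 0)
    obtain ⟨δ, hδ, h⟩ := hg_small ε hε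
    rw [zero_add]
    exact (hg hδ.le).trans h
  have hlim : Tendsto g (𝓝[≥] 0) (𝓝 0) := by
    rw [Metric.tendsto_nhds]
    intro ε hε
    obtain ⟨δ, hδ, h⟩ := hg_small (ε / 2) (half_pos hε)
    filter_upwards [mem_nhdsWithin_of_mem_nhds (Iio_mem_nhds hδ)] with r hr
    rw [Real.dist_eq, sub_zero, abs_of_nonneg (hg_nonneg r)]
    linarith [hg (le_of_lt (mem_Iio.1 hr))]
  obtain ⟨κ, hκ, hle⟩ := exists_isClassKInfty_ge hg hg0 hlim
  exact ⟨κ, hκ, fun i r hi ↦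
    (le_csSup (hS r) (mem_insert_of_mem _ (mem_image_of_mem q hi))).trans (hle r)⟩

/-! ### Sublevel sets of the Lyapunov function -/

section Sublevel

variable {E : Type*} [NormedAddCommGroup E] [ProperSpace E] {V : E → ℝ} {α : ℝ}

lemma isCompact_sublevel (hV : Continuous V) (hVinf : Tendsto V (Bornology.cobounded E) atTop)
    (c : ℝ) : IsCompact {x | V x ≤ c} := by
  refine Metric.isCompact_of_isClosed_isBounded (isClosed_le hV continuous_const) ?_
  rw [← Bornology.isCobounded_compl_iff, Bornology.isCobounded_def]
  filter_upwards [hVinf.eventually_gt_atTop c] with x hx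
  simpa using hx

lemma exists_forall_infDist_le_of_lt (hV : Continuous V)
    (hVinf : Tendsto V (Bornology.cobounded E) atTop) {ε : ℝ} (hε : 0 < ε) :
    ∃ η > 0, ∀ y, V y < α + η → Metric.infDist y {x | V x ≤ α} ≤ ε := by
  let K : Set E := {y | V y ≤ α + 1} ∩ {y | ε ≤ Metric.infDist y {x | V x ≤ α}}
  have hK : IsCompact K := (isCompact_sublevel hV hVinf _).inter_right
    (isClosed_le continuous_const (Metric.continuous_infDist_pt _))
  rcases K.eq_empty_or_nonempty with hemp | hne
  · refine ⟨1, one_pos, fun y hy ↦ ?_⟩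
    by_contra! hcon
    exact (hemp ▸ (⟨hy.le, hcon.le⟩ : y ∈ K) : y ∈ (∅ : Set E))
  · obtain ⟨y₀, hy₀, hmin⟩ := hK.exists_isMinOn hne hV.continuousOn
    have hlt : α < V y₀ := by
      by_contra! hcon
      have h0 : Metric.infDist y₀ {x | V x ≤ α} = 0 := Metric.infDist_zero_of_mem hcon
      have := hy₀.2
      rw [mem_ofPred_eq, h0] at this
      linarith
    refine ⟨min 1 (V y₀ - α), lt_min one_pos (by linarith), fun y hy ↦ ?_⟩
    by_contra! hcon
    have h1 := hmin (⟨hy.le.trans (by linarith [min_le_left 1 (V y₀ - α)]), hcon.le⟩ :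
      y ∈ K)
    rw [mem_ofPred_eq] at h1
    linarith [min_le_right 1 (V y₀ - α)]

lemma exists_forall_lt_of_infDist_le (hV : Continuous V)
    (hVinf : Tendsto V (Bornology.cobounded E) atTop) (hne : {x | V x ≤ α}.Nonempty)
    {η : ℝ} (hη : 0 < η) :
    ∃ δ > 0, ∀ x, Metric.infDist x {x | V x ≤ α} ≤ δ → V x < α + η := by
  have hK := isCompact_sublevel hV hVinf α
  obtain ⟨δ, hδ, hsub⟩ := hK.exists_cthickening_subset_open
    (isOpen_lt hV (continuous_const (y := α + η))) fun x (hx : V x ≤ α) ↦ by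
      simpa using hx.trans_lt (lt_add_of_pos_right α hη)
  refine ⟨δ, hδ, fun x hx ↦ hsub ?_⟩
  obtain ⟨y, hy, hxy⟩ := hK.exists_infDist_eq_dist hne x
  exact Metric.mem_cthickening_of_dist_le x y δ _ hy (hxy ▸ hx)

lemma exists_forall_le_of_infDist_le (hV : Continuous V)
    (hVinf : Tendsto V (Bornology.cobounded E) atTop) (hne : {x | V x ≤ α}.Nonempty) (r : ℝ) :
    ∃ B, ∀ x, Metric.infDist x {x | V x ≤ α} ≤ r → V x ≤ B := by
  have hK := isCompact_sublevel hV hVinf α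
  obtain ⟨R, hR⟩ := hK.isBounded.exists_norm_le
  obtain ⟨B, hB⟩ := ((isCompact_closedBall (0 : E) (R + r)).image hV).bddAbove
  refine ⟨B, fun x hx ↦ hB (mem_image_of_mem V ?_)⟩
  obtain ⟨y, hy, hxy⟩ := hK.exists_infDist_eq_dist hne x
  rw [mem_closedBall_zero_iff]
  have h1 : ‖x‖ ≤ ‖y‖ + ‖x - y‖ := by simpa using norm_add_le y (x - y)
  rw [← dist_eq_norm, ← hxy] at h1
  linarith [hR y hy]

end Sublevel

/-! ### Decay along solutions -/

section Decay

variable {n : ℕ} {F : EuclideanSpace ℝ (Fin n) → Set (EuclideanSpace ℝ (Fin n))}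
  {V : EuclideanSpace ℝ (Fin n) → ℝ} {ρ α : ℝ}

/-- Where `V` is at least `α > 0` it has to decrease strictly along some direction. -/
lemma gradient_ne_zero_of_decrease (hne : ∀ x, (F x).Nonempty) (hρ : 0 < ρ) (hα : 0 < α)
    (hdecr : ∀ x, α ≤ V x → ∀ f ∈ F x, inner ℝ (gradient V x) f ≤ -ρ * V x)
    {x : EuclideanSpace ℝ (Fin n)} (hx : α ≤ V x) : gradient V x ≠ 0 := by
  intro h0
  obtain ⟨f, hf⟩ := hne x
  have h1 := hdecr x hx f hf
  rw [h0, inner_zero_left] at h1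
  nlinarith [mul_pos hρ (hα.trans_le hx)]

lemma not_isLocalMin_of_decrease (hne : ∀ x, (F x).Nonempty) (hρ : 0 < ρ) (hα : 0 < α)
    (hdecr : ∀ x, α ≤ V x → ∀ f ∈ F x, inner ℝ (gradient V x) f ≤ -ρ * V x)
    {x : EuclideanSpace ℝ (Fin n)} (hx : α ≤ V x) : ¬ IsLocalMin V x := by
  intro hmin
  refine gradient_ne_zero_of_decrease hne hρ hα hdecr hx ?_
  rw [gradient, hmin.fderiv_eq_zero, map_zero]

/-- Since `V` has no critical point at level `α`, the complement of the interior of the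
superlevel set is the sublevel set. -/
lemma compl_interior_superlevel_eq (hV : Continuous V) (hne : ∀ x, (F x).Nonempty) (hρ : 0 < ρ)
    (hα : 0 < α) (hdecr : ∀ x, α ≤ V x → ∀ f ∈ F x, inner ℝ (gradient V x) f ≤ -ρ * V x) :
    (interior {x | α ≤ V x})ᶜ = {x | V x ≤ α} := by
  ext x
  rw [mem_compl_iff, mem_interior_iff_mem_nhds, mem_ofPred_eq]
  constructor
  · intro h
    by_contra! hlt
    exact h ((hV.tendsto x).eventually (lt_mem_nhds hlt) |>.mono fun y hy ↦ le_of_lt hy)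
  · intro hle hmem
    have hx : V x = α := le_antisymm hle (mem_of_mem_nhds (s := {y | α ≤ V y}) hmem)
    refine not_isLocalMin_of_decrease hne hρ hα hdecr hx.ge ?_
    filter_upwards [hmem] with y hy
    exact hx ▸ hy

/-- Along solutions `V` decays exponentially until it falls to the level `α`, and it never rises
above this level again. -/
lemma IsSolution.le_max_exp_mul (hV : ContDiff ℝ 1 V)
    (hdecr : ∀ x, α ≤ V x → ∀ f ∈ F x, inner ℝ (gradient V x) f ≤ -ρ * V x) (hρ : 0 ≤ ρ)
    (hα : 0 ≤ α) {D : Set ℝ} {φ : ℝ → EuclideanSpace ℝ (Fin n)} (hφ : IsSolution F D φ)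
    {t : ℝ} (ht : t ∈ D) : V (φ t) ≤ max α (Real.exp (-ρ * t) * V (φ 0)) := by
  have ht0 := hφ.nonneg t ht
  have hcont : ContinuousOn (fun s ↦ V (φ s)) (Icc 0 t) := by
    have := (hφ.absolutelyContinuous 0 hφ.zero_mem t ht).continuousOn
    rw [uIcc_of_le ht0] at this
    exact hV.continuous.comp_continuousOn this
  -- While `V` exceeds `α`, the function `exp (ρ * s) * V (φ s)` does not increase.
  have key : ∀ s ∈ Icc 0 t, (∀ u ∈ Ioo s t, α < V (φ u)) →
      V (φ t) ≤ Real.exp (-ρ * (t - s)) * V (φ s) := by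
    intro s hs habove
    have hsD := hφ.Icc_subset le_rfl ht hs
    have hexp : AbsolutelyContinuousOnInterval (fun u ↦ Real.exp (ρ * u)) s t :=
      ContDiffOn.absolutelyContinuousOnInterval (by fun_prop)
    have hac := hexp.mul
      (hV.comp_absolutelyContinuousOnInterval (hφ.absolutelyContinuous s hsD t ht))
    have hmono := le_of_ae_deriv_nonpos hs.2 hac (by
      filter_upwards [hφ.ae_hasDerivAt hs.1 ht] with u hu hust
      obtain ⟨v, hv, hd⟩ := hu hust
      have hVd : HasDerivAt (V ∘ φ) (inner ℝ (gradient V (φ u)) v) u := by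
        rw [gradient, InnerProductSpace.toDual_symm_apply]
        exact (hV.differentiable one_ne_zero (φ u)).hasFDerivAt.comp_hasDerivAt u hd
      have hed : HasDerivAt (fun u ↦ Real.exp (ρ * u)) (Real.exp (ρ * u) * ρ) u := by
        simpa using ((hasDerivAt_id u).const_mul ρ).exp
      rw [(hed.mul hVd).deriv]
      have h1 := hdecr (φ u) (habove u hust).le v hv
      have h2 := mul_le_mul_of_nonneg_left h1 (Real.exp_pos (ρ * u)).le
      simp only [Function.comp_apply]
      linarith)
    simp only [Pi.mul_apply, Function.comp_apply] at hmono
    have h3 := mul_le_mul_of_nonneg_left hmono (Real.exp_pos (-ρ * t)).le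
    rw [← mul_assoc, ← mul_assoc, ← Real.exp_add, ← Real.exp_add] at h3
    rw [show -ρ * t + ρ * t = 0 by ring, Real.exp_zero, one_mul,
      show -ρ * t + ρ * s = -ρ * (t - s) by ring] at h3
    exact h3
  let S : Set ℝ := Icc 0 t ∩ (fun s ↦ V (φ s)) ⁻¹' Iic α
  have hS : IsCompact S := isCompact_Icc.of_isClosed_subset
    (hcont.preimage_isClosed_of_isClosed isClosed_Icc isClosed_Iic) inter_subset_left
  rcases S.eq_empty_or_nonempty with hemp | hne
  · have h1 := key 0 ⟨le_rfl, ht0⟩ fun u hu ↦ by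
      by_contra! hcon
      exact (hemp ▸ (⟨Ioo_subset_Icc_self hu, hcon⟩ : u ∈ S) : u ∈ (∅ : Set ℝ))
    rw [sub_zero] at h1
    exact h1.trans (le_max_right _ _)
  · -- The last time at which `V` is at most `α`.
    obtain ⟨s, hs, hlast⟩ := hS.exists_isGreatest hne
    have h1 := key s hs.1 fun u hu ↦ by
      by_contra! hcon
      exact (hlast ⟨⟨hs.1.1.trans hu.1.le, hu.2.le⟩, hcon⟩).not_gt hu.1
    refine le_max_of_le_left (h1.trans ?_)
    have hs2 : V (φ s) ≤ α := hs.2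
    have hexp1 : Real.exp (-ρ * (t - s)) ≤ 1 :=
      Real.exp_le_one_iff.2 (by nlinarith [mul_nonneg hρ (sub_nonneg.2 hs.1.2)])
    calc _ ≤ Real.exp (-ρ * (t - s)) * α := mul_le_mul_of_nonneg_left hs2 (Real.exp_pos _).le
      _ ≤ 1 * α := mul_le_mul_of_nonneg_right hexp1 hα
      _ = α := one_mul α

lemma IsSolution.le_max (hV : ContDiff ℝ 1 V)
    (hdecr : ∀ x, α ≤ V x → ∀ f ∈ F x, inner ℝ (gradient V x) f ≤ -ρ * V x) (hρ : 0 ≤ ρ)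
    (hα : 0 ≤ α) {D : Set ℝ} {φ : ℝ → EuclideanSpace ℝ (Fin n)} (hφ : IsSolution F D φ)
    {t : ℝ} (ht : t ∈ D) : V (φ t) ≤ max α (V (φ 0)) := by
  refine (hφ.le_max_exp_mul hV hdecr hρ hα ht).trans (max_le (le_max_left _ _) ?_)
  have hexp1 : Real.exp (-ρ * t) ≤ 1 :=
    Real.exp_le_one_iff.2 (by nlinarith [mul_nonneg hρ (hφ.nonneg t ht)])
  rcases le_total (V (φ 0)) 0 with h | h
  · exact le_max_of_le_left ((mul_nonpos_of_nonneg_of_nonpos (Real.exp_pos _).le h).trans hα)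
  · exact le_max_of_le_right (mul_le_of_le_one_left h hexp1)

end Decay

/-! ### Uniform global asymptotic stability -/

section Stability

variable {n : ℕ} {F : EuclideanSpace ℝ (Fin n) → Set (EuclideanSpace ℝ (Fin n))}
  {V : EuclideanSpace ℝ (Fin n) → ℝ} {ρ α : ℝ}

lemma globallyUniformlyStable_sublevel (hV : ContDiff ℝ 1 V)
    (hVinf : Tendsto V (Bornology.cobounded _) atTop) (hne : {x | V x ≤ α}.Nonempty)
    (hdecr : ∀ x, α ≤ V x → ∀ f ∈ F x, inner ℝ (gradient V x) f ≤ -ρ * V x) (hρ : 0 ≤ ρ)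
    (hα : 0 ≤ α) : GloballyUniformlyStable F {x | V x ≤ α} := by
  -- The pairs of an initial point and a point that the decay of `V` allows to be reached from it.
  let ι := {z : EuclideanSpace ℝ (Fin n) × EuclideanSpace ℝ (Fin n) // V z.2 ≤ max α (V z.1)}
  obtain ⟨κ, hκ, hle⟩ := exists_isClassKInfty_of_bounded_of_small
    (p := fun i : ι ↦ Metric.infDist i.1.1 {x | V x ≤ α})
    (q := fun i : ι ↦ Metric.infDist i.1.2 {x | V x ≤ α})
    (by
      intro r
      obtain ⟨B, hB⟩ := exists_forall_le_of_infDist_le hV.continuous hVinf hne r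
      obtain ⟨B', hB'⟩ := ((isCompact_sublevel hV.continuous hVinf (max α B)).image
        (Metric.continuous_infDist_pt {x | V x ≤ α})).bddAbove
      exact ⟨B', fun i hi ↦ hB' (mem_image_of_mem _
        (i.2.trans (max_le_max_left α (hB _ hi))))⟩)
    (by
      intro ε hε
      obtain ⟨η, hη, h1⟩ := exists_forall_infDist_le_of_lt (α := α) hV.continuous hVinf hε
      obtain ⟨δ, hδ, h2⟩ := exists_forall_lt_of_infDist_le hV.continuous hVinf hne hη
      exact ⟨δ, hδ, fun i hi ↦ h1 _ (i.2.trans_lt (max_lt (by linarith) (h2 _ hi)))⟩)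
  refine ⟨κ, hκ, fun D φ hφ t ht ↦ ?_⟩
  have h := hle ⟨(φ 0, φ t), hφ.le_max hV hdecr hρ hα ht⟩
    (Metric.infNndist (φ 0) {x | V x ≤ α}) (le_of_eq (Metric.coe_infNndist ..).symm)
  rw [← NNReal.coe_le_coe, Metric.coe_infNndist]
  exact h

lemma uniformlyGloballyAttractive_sublevel (hF : BasicConditions F) (hV : ContDiff ℝ 1 V)
    (hVinf : Tendsto V (Bornology.cobounded _) atTop) (hne : {x | V x ≤ α}.Nonempty)
    (hdecr : ∀ x, α ≤ V x → ∀ f ∈ F x, inner ℝ (gradient V x) f ≤ -ρ * V x) (hρ : 0 < ρ)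
    (hα : 0 < α) : UniformlyGloballyAttractive F {x | V x ≤ α} := by
  refine ⟨fun D φ hφ ↦ hφ.isCompleteDomain hF
    (isCompact_sublevel hV.continuous hVinf (max α (V (φ 0))))
    fun t ht ↦ hφ.1.le_max hV hdecr hρ.le hα.le ht, fun ε hε μ _ ↦ ?_⟩
  obtain ⟨η, hη, h1⟩ := exists_forall_infDist_le_of_lt (α := α) hV.continuous hVinf hε
  obtain ⟨B, hB⟩ := exists_forall_le_of_infDist_le hV.continuous hVinf hne μ
  have hlim : Tendsto (fun t : ℝ ↦ Real.exp (-ρ * t) * B) atTop (𝓝 0) := by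
    have h2 : Tendsto (fun t : ℝ ↦ Real.exp (-ρ * t)) atTop (𝓝 0) :=
      Real.tendsto_exp_atBot.comp (tendsto_id.const_mul_atTop_of_neg (neg_lt_zero.2 hρ))
    simpa using h2.mul_const B
  obtain ⟨T, hT⟩ := eventually_atTop.1 (hlim.eventually_lt_const (by linarith : 0 < α + η))
  refine ⟨max T 1, lt_max_of_lt_right one_pos, fun D φ hφ h0 t ht hTt ↦ h1 _ ?_⟩
  refine (hφ.le_max_exp_mul hV hdecr hρ.le hα.le ht).trans_lt (max_lt (by linarith) ?_)
  exact (mul_le_mul_of_nonneg_left (hB _ h0) (Real.exp_pos _).le).trans_lt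
    (hT t ((le_max_left _ _).trans hTt))

end Stability

end DiffIncl

theorem mainTheorem5 (n : ℕ)
    (F : EuclideanSpace ℝ (Fin n) → Set (EuclideanSpace ℝ (Fin n)))
    (hF : DiffIncl.BasicConditions F)
    (V : EuclideanSpace ℝ (Fin n) → ℝ)
    (hV : ContDiff ℝ 1 V)
    (hV_pos : ∀ x, x ≠ 0 → 0 < V x)
    (hV_unbounded : Filter.Tendsto V (Bornology.cobounded _) Filter.atTop)
    (ρ α : ℝ) (hρ : 0 < ρ) (hα : 0 < α)
    (hdecr : ∀ x, α ≤ V x → ∀ f ∈ F x, inner ℝ (gradient V x) f ≤ -ρ * V x) :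
    DiffIncl.UGAS F (interior {x | α ≤ V x})ᶜ := by
  rw [DiffIncl.compl_interior_superlevel_eq hV.continuous hF.nonempty hρ hα hdecr]
  have hne : {x | V x ≤ α}.Nonempty := by
    -- A global minimum of `V` lies below the level `α`, since it is a critical point.
    obtain ⟨x, hx⟩ := hV.continuous.exists_forall_le
      (Metric.cobounded_eq_cocompact (α := EuclideanSpace ℝ (Fin n)) ▸ hV_unbounded)
    refine ⟨x, ?_⟩
    by_contra! hcon
    exact DiffIncl.not_isLocalMin_of_decrease hF.nonempty hρ hα hdecr
      (not_le.1 hcon).le (Filter.Eventually.of_forall hx)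
  exact ⟨hne, isClosed_le hV.continuous continuous_const,
    DiffIncl.globallyUniformlyStable_sublevel hV hV_unbounded hne hdecr hρ.le hα.le,
    DiffIncl.uniformlyGloballyAttractive_sublevel hF hV hV_unbounded hne hdecr hρ hα⟩
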